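/- Let $G=(V,E)$ be a finite simple undirected graph with $V\neq\emptyset$ and let $X\subseteq V$. Write $\mathit{MC}(G)$ and $\mathit{MS}(G)$ for the sets of maximal cliques and of maximal stable (independent) sets of $G$. Say that $G(X,1)$ holds if some $S\in\mathit{MC}(G)$ satisfies $S\subseteq X$, and that $G(X,0)$ holds if some $T\in\mathit{MS}(G)$ satisfies $T\cap X=\emptyset$. Call $G$ deterministic if for no $Y\subseteq V$ both $G(Y,0)$ and $G(Y,1)$ hold. A module of $G$ is a set $M\subseteq V$ all of whose elements have the same neighbours outside $M$. The decomposition tree $T(G)$ is defined by recursion: if $V=\{x\}$ it is the leaf $x$; if $G$ is disconnected, its root is labelled $\vee$ and its children are the trees of the connected components of $G$; if the complement $\overline G$ is disconnected, its root is labelled $\wedge$ and its children are the trees of the subgraphs of $G$ induced by the connected components of $\overline G$; otherwise, with $P$ the set of maximal proper modules of $G$, its root is a prime node labelled by the quotient graph $G/P$ (with vertex set $P$, where distinct $M,N\in P$ are adjacent iff all vertices of $M$ are adjacent in $G$ to all vertices of $N$) and its children are the trees of the subgraphs induced by the $M\in P$. The evaluation game is played from the root of $T(G)$. At a $\vee$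 node Eloise chooses a child, and at a $\wedge$ node Abelard chooses a child. At a prime node with quotient $Q$, Eloise chooses some $S\in\mathit{MC}(Q)$ and Abelard some $T\in\mathit{MS}(Q)$; play continues at the unique element of $S\cap T$ if there is one, and otherwise ends with outcome $\emptyset$ (a draw). A play that reaches a leaf $x$ has outcome $x$; Eloise wins it if $x\in X$, and Abelard wins it if $x\notin X$. A static strategy for Eloise assigns to each $\vee$ node of $T(G)$ a child and to each prime node a maximal clique of its quotient; a static strategy for Abelard assigns to each $\wedge$ node a child and to each prime node a maximal stable set of its quotient (in both cases independently of the opponent's moves). A strategy of a player is winning if that player wins every play consistent with it, and drawing if every play consistent with it is a win for that player or a draw. Then: 1. $G(X,1)$ holds if and only if Eloise has a static drawing strategy. 2. $G(X,0)$ holds if and only if Abelard has a static drawing strategy. 3. If $G$ is deterministic, then $G(X,1)$ holds if and only if Eloise has a static winning strategy, and $G(X,0)$ holds if and only if Abelard has a static winning strategy. -/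

import Mathlib

namespace BGL

universe u

/-! ### Evaluation of graphs -/

/-- `MC G`: the maximal cliques of `G`. -/
def MC {W : Type u} (G : SimpleGraph W) : Set (Set W) :=
  {S | Maximal (fun A : Set W => G.IsClique A) S}

/-- `MS G`: the maximal stable (independent) sets of `G`. -/
def MS {W : Type u} (G : SimpleGraph W) : Set (Set W) :=
  {T | Maximal (fun A : Set W => G.IsIndepSet A) T}

/-- `G(X,1)`. -/
def EvalsToOne {V : Type u} (G : SimpleGraph V) (X : Set V) : Prop :=
  ∃ S ∈ MC G, S ⊆ X

/-- `G(X,0)`. -/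
def EvalsToZero {V : Type u} (G : SimpleGraph V) (X : Set V) : Prop :=
  ∃ T ∈ MS G, X ∩ T = ∅

/-- `G` is deterministic: no assignment evaluates to both `0` and `1`. -/
def Deterministic {V : Type u} (G : SimpleGraph V) : Prop :=
  ∀ X : Set V, ¬ (EvalsToZero G X ∧ EvalsToOne G X)

/-! ### Modules and quotients -/

/-- `M` is a module of `G`: all elements of `M` have the same neighbourhood outside `M`. -/
def IsModule {W : Type u} (G : SimpleGraph W) (M : Set W) : Prop :=
  ∀ x ∈ M, ∀ y ∈ M, ∀ z, z ∉ M → (G.Adj x z ↔ G.Adj y z)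

/-- The vertex sets of the connected components of the induced subgraph `G ↾ M`,
as subsets of `V`. -/
def components {V : Type u} (G : SimpleGraph V) (M : Set V) : Set (Set V) :=
  {N | ∃ c : (G.induce M).ConnectedComponent, N = Subtype.val '' c.supp}

/-- The maximal proper modules of the induced subgraph `G ↾ M`, as subsets of `V`. -/
def maxProperModules {V : Type u} (G : SimpleGraph V) (M : Set V) : Set (Set V) :=
  {N | ∃ K : Set M,
    Maximal (fun A : Set M => IsModule (G.induce M) A ∧ A ≠ Set.univ) K ∧
      N = Subtype.val '' K}

/-- The quotient graph on a set `P` of modules: `M` and `N` are adjacent if every vertex of `M`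
is adjacent in `G` to every vertex of `N`. -/
def quotientGraph {V : Type u} (G : SimpleGraph V) (P : Set (Set V)) : SimpleGraph P where
  Adj M N := M ≠ N ∧ ∀ x ∈ M.1, ∀ y ∈ N.1, G.Adj x y
  symm := ⟨fun _ _ h => ⟨h.1.symm, fun x hx y hy => (h.2 y hy x hx).symm⟩⟩
  loopless := ⟨fun _ h => h.1 rfl⟩

theorem components_ssubset {V : Type u} {G : SimpleGraph V} {M N : Set V}
    (hM : ¬ (G.induce M).Connected) (hN : N ∈ components G M) : N ⊂ M := by
  obtain ⟨c, rfl⟩ := hN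
  refine ⟨by rintro _ ⟨x, -, rfl⟩; exact x.2, fun hsub => hM ?_⟩
  have hall : ∀ x : M, x ∈ c.supp := by
    intro x
    obtain ⟨y, hy, hyx⟩ := hsub x.2
    rwa [← Subtype.ext hyx]
  obtain ⟨v, hv⟩ := c.nonempty_supp
  have : Nonempty M := ⟨v⟩
  refine SimpleGraph.Connected.mk fun x y => ?_
  exact SimpleGraph.ConnectedComponent.exact ((hall x).trans (hall y).symm)

theorem maxProperModules_ssubset {V : Type u} {G : SimpleGraph V} {M N : Set V}
    (hN : N ∈ maxProperModules G M) : N ⊂ M := by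
  obtain ⟨K, hK, rfl⟩ := hN
  refine ⟨by rintro _ ⟨x, -, rfl⟩; exact x.2, fun hsub => hK.prop.2 ?_⟩
  refine Set.eq_univ_of_forall fun x => ?_
  obtain ⟨y, hy, hyx⟩ := hsub x.2
  rwa [← Subtype.ext hyx]

/-! ### Decomposition trees -/

/-- Trees whose leaves are vertices and whose internal nodes are labelled by `∨`, by `∧`, or by a
graph on the set of children. The children of a node are indexed by a set of subsets of `V`. -/
inductive DecTree (V : Type u) : Type u
  | leaf (x : V) : DecTree V
  | or (P : Set (Set V)) (child : P → DecTree V) : DecTree V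
  | and (P : Set (Set V)) (child : P → DecTree V) : DecTree V
  | prime (P : Set (Set V)) (Q : SimpleGraph P) (child : P → DecTree V) : DecTree V

open Classical in
/-- The decomposition tree of the induced subgraph `G ↾ M`.
Here `Gᶜ ↾ M` is the complement of `G ↾ M`. -/
noncomputable def decTreeOn {V : Type u} [Finite V] (G : SimpleGraph V) (M : Set V) :
    DecTree V :=
  if h : ∃ x, M = {x} then
    .leaf h.choose
  else if _hd : ¬ (G.induce M).Connected then
    .or (components G M) fun N => decTreeOn G N.1
  else if _hc : ¬ (Gᶜ.induce M).Connected then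
    .and (components Gᶜ M) fun N => decTreeOn G N.1
  else
    .prime (maxProperModules G M) (quotientGraph G (maxProperModules G M))
      fun N => decTreeOn G N.1
termination_by M.ncard
decreasing_by
  · exact Set.ncard_lt_ncard (components_ssubset _hd N.2) (Set.toFinite M)
  · exact Set.ncard_lt_ncard (components_ssubset _hc N.2) (Set.toFinite M)
  · exact Set.ncard_lt_ncard (maxProperModules_ssubset N.2) (Set.toFinite M)

/-- The (modular) decomposition tree of `G`. -/
noncomputable def decTree {V : Type u} [Finite V] (G : SimpleGraph V) : DecTree V :=
  decTreeOn G Set.univ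

/-! ### The evaluation game -/

/-- The plays of the game on a tree. At a `∨` node Eloise chooses a child, at a `∧` node Abelard
does. At a prime node Eloise chooses a maximal clique `S` and Abelard a maximal stable set `T`
of the quotient; the play ends in a deadlock if `S ∩ T = ∅` and otherwise continues on
the (unique) element of `S ∩ T`. -/
inductive Play {V : Type u} : DecTree V → Type u
  | leaf (x : V) : Play (.leaf x)
  | or {P : Set (Set V)} {child : P → DecTree V} (i : P) (p : Play (child i)) :
      Play (.or P child)
  | and {P : Set (Set V)} {child : P → DecTree V} (i : P) (p : Play (child i)) :
      Play (.and P child)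
  | deadlock {P : Set (Set V)} {Q : SimpleGraph P} {child : P → DecTree V}
      (S : MC Q) (T : MS Q) (h : S.1 ∩ T.1 = ∅) : Play (.prime P Q child)
  | prime {P : Set (Set V)} {Q : SimpleGraph P} {child : P → DecTree V}
      (S : MC Q) (T : MS Q) (i : P) (h : i ∈ S.1 ∩ T.1) (p : Play (child i)) :
      Play (.prime P Q child)

/-- The outcome of a play: a vertex, or `none` in the case of a deadlock. -/
def Play.outcome {V : Type u} : {t : DecTree V} → Play t → Option V
  | _, .leaf x => some x
  | _, .or _ p => p.outcome
  | _, .and _ p => p.outcome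
  | _, .deadlock _ _ _ => none
  | _, .prime _ _ _ _ p => p.outcome

/-- Eloise wins the play with respect to the assignment `X`. -/
def Play.EloiseWins {V : Type u} {t : DecTree V} (p : Play t) (X : Set V) : Prop :=
  ∃ x ∈ X, p.outcome = some x

/-- Abelard wins the play with respect to the assignment `X`. -/
def Play.AbelardWins {V : Type u} {t : DecTree V} (p : Play t) (X : Set V) : Prop :=
  ∃ x ∉ X, p.outcome = some x

/-- The play is a draw. -/
def Play.IsDraw {V : Type u} {t : DecTree V} (p : Play t) : Prop :=
  p.outcome = none

/-- Static strategies for Eloise: a choice of a child at each `∨` node of the tree and of a maximal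
clique of the quotient at each prime node, independent of the moves of Abelard. -/
def EloiseStrategy {V : Type u} : DecTree V → Type u
  | .leaf _ => PUnit
  | .or P child => P × ((i : P) → EloiseStrategy (child i))
  | .and P child => (i : P) → EloiseStrategy (child i)
  | .prime P Q child => MC Q × ((i : P) → EloiseStrategy (child i))

/-- Static strategies for Abelard: a choice of a child at each `∧` node of the tree and of a maximal
stable set of the quotient at each prime node, independent of the moves of Eloise. -/
def AbelardStrategy {V : Type u} : DecTree V → Type u
  | .leaf _ => PUnit
  | .or P child => (i : P) → AbelardStrategy (child i)
  | .and P child => P × ((i : P) → AbelardStrategy (child i))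
  | .prime P Q child => MS Q × ((i : P) → AbelardStrategy (child i))

/-- In the play, Eloise moves according to her strategy (and Abelard moves arbitrarily). -/
def Play.FollowsEloise {V : Type u} : {t : DecTree V} → Play t → EloiseStrategy t → Prop
  | _, .leaf _, _ => True
  | _, .or i p, σ => i = σ.1 ∧ p.FollowsEloise (σ.2 i)
  | _, .and i p, σ => p.FollowsEloise (σ i)
  | _, .deadlock S _ _, σ => S = σ.1
  | _, .prime S _ i _ p, σ => S = σ.1 ∧ p.FollowsEloise (σ.2 i)

/-- In the play, Abelard moves according to his strategy (and Eloise moves arbitrarily). -/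
def Play.FollowsAbelard {V : Type u} : {t : DecTree V} → Play t → AbelardStrategy t → Prop
  | _, .leaf _, _ => True
  | _, .or i p, τ => p.FollowsAbelard (τ i)
  | _, .and i p, τ => i = τ.1 ∧ p.FollowsAbelard (τ.2 i)
  | _, .deadlock _ T _, τ => T = τ.1
  | _, .prime _ T i _ p, τ => T = τ.1 ∧ p.FollowsAbelard (τ.2 i)

/-- Every play according to `σ` is a win for Eloise. -/
def EloiseStrategy.IsWinning {V : Type u} {t : DecTree V} (σ : EloiseStrategy t)
    (X : Set V) : Prop :=
  ∀ p : Play t, p.FollowsEloise σ → p.EloiseWins X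

/-- Every play according to `σ` is a win for Eloise or a draw. -/
def EloiseStrategy.IsDrawing {V : Type u} {t : DecTree V} (σ : EloiseStrategy t)
    (X : Set V) : Prop :=
  ∀ p : Play t, p.FollowsEloise σ → p.EloiseWins X ∨ p.IsDraw

/-- Every play according to `τ` is a win for Abelard. -/
def AbelardStrategy.IsWinning {V : Type u} {t : DecTree V} (τ : AbelardStrategy t)
    (X : Set V) : Prop :=
  ∀ p : Play t, p.FollowsAbelard τ → p.AbelardWins X

/-- Every play according to `τ` is a win for Abelard or a draw. -/
def AbelardStrategy.IsDrawing {V : Type u} {t : DecTree V} (τ : AbelardStrategy t)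
    (X : Set V) : Prop :=
  ∀ p : Play t, p.FollowsAbelard τ → p.AbelardWins X ∨ p.IsDraw

end BGL

/-!
Let `P` be a partition of the vertices into modules. A maximal clique of `G` meets the parts in a
maximal clique of the quotient, and each part it meets in a maximal clique of that part; conversely,
maximal cliques of the parts along a maximal clique of the quotient glue to one of `G`. Hence
`G(X,1)` holds exactly if the quotient evaluates to one at the set of parts that do. The nodes of
the tree are instances of this with an edgeless (`∨`), complete (`∧`) or arbitrary quotient. Since
every vertex of a quotient lies in a maximal stable set, Eloise can draw from a node exactly if some
maximal clique of its quotient consists of children from which she can draw. This gives part 1 by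
induction on the tree, and part 2 follows by complementing the graph, which exchanges the players.
In a deterministic graph every maximal clique meets every maximal stable set; modules and quotients
inherit this, so no play ends in a draw.
-/

namespace BGL

variable {V : Type*}

/-! ### Maximal cliques relative to a set of vertices -/

/-- The maximal cliques of the induced subgraph `G ↾ M`, as subsets of `V`; the maximal stable sets
of `G ↾ M` are `MCOn Gᶜ M`. -/
def MCOn (G : SimpleGraph V) (M : Set V) : Set (Set V) :=
  {S | Maximal (fun A : Set V => A ⊆ M ∧ G.IsClique A) S}

section MaximalCliques

variable {G : SimpleGraph V} {M S A X : Set V}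

@[simp]
theorem MCOn_univ (G : SimpleGraph V) : MCOn G Set.univ = MC G := by
  simp [MC, MCOn]

theorem mem_MCOn_iff :
    S ∈ MCOn G M ↔ S ⊆ M ∧ G.IsClique S ∧ ∀ x ∈ M, (∀ s ∈ S, x ≠ s → G.Adj x s) → x ∈ S := by
  constructor
  · intro (h : Maximal (fun A : Set V => A ⊆ M ∧ G.IsClique A) S)
    refine ⟨h.prop.1, h.prop.2, fun x hx hadj => ?_⟩
    exact h.le_of_ge ⟨Set.insert_subset hx h.prop.1, h.prop.2.insert hadj⟩
      (Set.subset_insert x S) (Set.mem_insert x S)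
  · rintro ⟨hSM, hS, hmax⟩
    exact ⟨⟨hSM, hS⟩, fun A hA hSA a ha => hmax a (hA.1 ha) fun s hs => hA.2 ha (hSA hs)⟩

theorem mem_MC_iff : S ∈ MC G ↔ G.IsClique S ∧ ∀ x, (∀ s ∈ S, x ≠ s → G.Adj x s) → x ∈ S := by
  simp [← MCOn_univ, mem_MCOn_iff]

theorem MC_compl (G : SimpleGraph V) : MC Gᶜ = MS G := by
  simp [MS, MC]

theorem MS_compl (G : SimpleGraph V) : MS Gᶜ = MC G := by
  simp [MS, MC]

theorem subset_of_mem_MCOn (hS : S ∈ MCOn G M) : S ⊆ M :=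
  (mem_MCOn_iff.1 hS).1

theorem isClique_of_mem_MCOn (hS : S ∈ MCOn G M) : G.IsClique S :=
  (mem_MCOn_iff.1 hS).2.1

theorem mem_of_mem_MCOn_of_subset_isClique (hS : S ∈ MCOn G M) (hA : G.IsClique A) (hSA : S ⊆ A)
    {x : V} (hxM : x ∈ M) (hxA : x ∈ A) : x ∈ S :=
  (mem_MCOn_iff.1 hS).2.2 x hxM fun _ hs => hA hxA (hSA hs)

theorem exists_mem_MCOn_superset (hAM : A ⊆ M) (hA : G.IsClique A) : ∃ S ∈ MCOn G M, A ⊆ S := by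
  obtain ⟨S, hAS, hS⟩ := zorn_subset_nonempty {B | B ⊆ M ∧ G.IsClique B}
    (fun c hc hchain _ => ⟨⋃₀ c,
      ⟨Set.sUnion_subset fun B hB => (hc hB).1,
        (SimpleGraph.isClique_sUnion hchain.directedOn).2 fun B hB => (hc hB).2⟩,
      fun _ => Set.subset_sUnion_of_mem⟩) A ⟨hAM, hA⟩
  exact ⟨S, hS, hAS⟩

theorem exists_mem_MC_mem (G : SimpleGraph V) (x : V) : ∃ S ∈ MC G, x ∈ S := by
  obtain ⟨S, hS, hxS⟩ := exists_mem_MCOn_superset (G := G) (Set.subset_univ {x}) (by simp)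
  exact ⟨S, MCOn_univ G ▸ hS, hxS rfl⟩

theorem exists_mem_MS_mem (G : SimpleGraph V) (x : V) : ∃ T ∈ MS G, x ∈ T :=
  MC_compl G ▸ exists_mem_MC_mem Gᶜ x

theorem MC_nonempty (G : SimpleGraph V) : (MC G).Nonempty := by
  obtain ⟨S, hS, -⟩ := exists_mem_MCOn_superset (G := G) (Set.empty_subset Set.univ) (by simp)
  exact ⟨S, MCOn_univ G ▸ hS⟩

theorem nonempty_of_mem_MCOn (hM : M.Nonempty) (hS : S ∈ MCOn G M) : S.Nonempty := by
  obtain ⟨x, hx⟩ := hM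
  by_contra! rfl
  exact (mem_MCOn_iff.1 hS).2.2 x hx (by simp)

theorem singleton_mem_MC_bot (x : V) : {x} ∈ MC (⊥ : SimpleGraph V) :=
  mem_MC_iff.2 ⟨by simp, fun _ h => by_contra fun hne => h x rfl hne⟩

theorem univ_mem_MC_top : Set.univ ∈ MC (⊤ : SimpleGraph V) :=
  mem_MC_iff.2 ⟨.top _, fun _ _ => trivial⟩

end MaximalCliques

/-! ### Evaluation relative to a set of vertices -/

/-- The induced subgraph `G ↾ M` evaluates to one; it evaluates to zero if
`EvalsToOneOn Gᶜ M Xᶜ`. -/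
def EvalsToOneOn (G : SimpleGraph V) (M X : Set V) : Prop :=
  ∃ S ∈ MCOn G M, S ⊆ X

section Evaluation

variable {G : SimpleGraph V} {X : Set V}

theorem evalsToOneOn_univ : EvalsToOneOn G Set.univ X ↔ EvalsToOne G X := by
  rw [EvalsToOneOn, MCOn_univ, EvalsToOne]

theorem evalsToOne_compl : EvalsToOne Gᶜ Xᶜ ↔ EvalsToZero G X := by
  simp only [EvalsToOne, EvalsToZero, MC_compl, ← Set.disjoint_iff_inter_eq_empty,
    Set.subset_compl_iff_disjoint_left]

theorem evalsToOneOn_singleton {x : V} : EvalsToOneOn G {x} X ↔ x ∈ X := by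
  constructor
  · rintro ⟨S, hS, hSX⟩
    obtain ⟨y, hy⟩ := nonempty_of_mem_MCOn (Set.singleton_nonempty x) hS
    obtain rfl : y = x := subset_of_mem_MCOn hS hy
    exact hSX hy
  · intro hx
    exact ⟨{x}, mem_MCOn_iff.2 ⟨subset_rfl, by simp, fun y hy _ => hy⟩, by simpa using hx⟩

theorem evalsToOne_bot [Nonempty V] : EvalsToOne (⊥ : SimpleGraph V) X ↔ X.Nonempty := by
  constructor
  · rintro ⟨S, hS, hSX⟩
    exact (nonempty_of_mem_MCOn Set.univ_nonempty (MCOn_univ (⊥ : SimpleGraph V) ▸ hS)).mono hSX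
  · rintro ⟨x, hx⟩
    exact ⟨{x}, singleton_mem_MC_bot x, by simpa using hx⟩

theorem evalsToOne_top : EvalsToOne (⊤ : SimpleGraph V) X ↔ X = Set.univ := by
  constructor
  · rintro ⟨S, hS, hSX⟩
    exact Set.eq_univ_of_forall fun x => hSX ((mem_MC_iff.1 hS).2 x fun s _ hne => hne)
  · rintro rfl
    exact ⟨Set.univ, univ_mem_MC_top, subset_rfl⟩

end Evaluation

/-! ### Modules -/

section Modules

variable {G : SimpleGraph V} {A B : Set V}

theorem compl_induce (G : SimpleGraph V) (M : Set V) : Gᶜ.induce M = (G.induce M)ᶜ := by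
  ext x y
  simp [SimpleGraph.compl_adj, Subtype.ext_iff]

theorem isModule_singleton (G : SimpleGraph V) (x : V) : IsModule G {x} := by
  rintro _ rfl _ rfl z _
  rfl

theorem IsModule.compl (hA : IsModule G A) : IsModule Gᶜ A := by
  intro x hx y hy z hz
  simp only [SimpleGraph.compl_adj, hA x hx y hy z hz, ne_of_mem_of_not_mem hx hz,
    ne_of_mem_of_not_mem hy hz, ne_eq, not_false_eq_true, true_and]

theorem IsModule.union (hA : IsModule G A) (hB : IsModule G B) (hAB : (A ∩ B).Nonempty) :
    IsModule G (A ∪ B) := by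
  obtain ⟨c, hcA, hcB⟩ := hAB
  have adj_iff_adj_common : ∀ x ∈ A ∪ B, ∀ z, z ∉ A ∪ B → (G.Adj x z ↔ G.Adj c z) := by
    rintro x (hx | hx) z hz
    · exact hA x hx c hcA z fun h => hz (Or.inl h)
    · exact hB x hx c hcB z fun h => hz (Or.inr h)
  exact fun x hx y hy z hz =>
    (adj_iff_adj_common x hx z hz).trans (adj_iff_adj_common y hy z hz).symm

theorem IsModule.adj_iff_of_induce {M N : Set V}
    (hN : IsModule (G.induce M) (Subtype.val ⁻¹' N)) (hNM : N ⊆ M) {x y z : V} (hx : x ∈ N)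
    (hy : y ∈ N) (hzM : z ∈ M) (hzN : z ∉ N) : G.Adj x z ↔ G.Adj y z :=
  hN ⟨x, hNM hx⟩ hx ⟨y, hNM hy⟩ hy ⟨z, hzM⟩ hzN

end Modules

/-! ### Maximal proper modules -/

/-- The maximal elements among the modules of `G` other than the whole vertex set. -/
def IsMaxProperModule (G : SimpleGraph V) (K : Set V) : Prop :=
  Maximal (fun A : Set V => IsModule G A ∧ A ≠ Set.univ) K

section MaxProperModules

variable {G : SimpleGraph V} {A B : Set V}

theorem exists_isMaxProperModule_mem [Finite V] [Nontrivial V] (G : SimpleGraph V) (x : V) :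
    ∃ K, IsMaxProperModule G K ∧ x ∈ K := by
  obtain ⟨K, hxK, hK⟩ :=
    (Set.toFinite {A : Set V | IsModule G A ∧ A ≠ Set.univ}).exists_le_maximal
      ⟨isModule_singleton G x, Set.singleton_ne_univ x⟩
  exact ⟨K, hK, hxK rfl⟩

theorem IsMaxProperModule.nonempty [Nontrivial V] (hA : IsMaxProperModule G A) : A.Nonempty := by
  obtain ⟨x⟩ := (inferInstance : Nonempty V)
  by_contra! rfl
  exact hA.le_of_ge ⟨isModule_singleton G x, Set.singleton_ne_univ x⟩ (Set.empty_subset _) rfl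

theorem not_connected_of_forall_not_adj (hA : A.Nonempty) (hA' : A ≠ Set.univ)
    (h : ∀ x ∈ A, ∀ y ∉ A, ¬ G.Adj x y) : ¬ G.Connected := by
  intro hG
  obtain ⟨x, hx⟩ := hA
  obtain ⟨y, hy⟩ := (Set.ne_univ_iff_exists_notMem A).1 hA'
  obtain ⟨w⟩ := hG.preconnected x y
  obtain ⟨d, -, hfst, hsnd⟩ := w.exists_boundary_dart A hx hy
  exact h _ hfst _ hsnd d.adj

-- The edge spreads: `y` sees all of `Bᶜ ⊆ A`, and then every vertex of `Bᶜ` sees all of `B ∋ y`.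
theorem IsModule.not_connected_compl (hA : IsModule G A) (hB : IsModule G B)
    (hAB : A ∪ B = Set.univ) {x y : V} (hx : x ∉ B) (hy : y ∉ A) (hxy : G.Adj x y) :
    ¬ Gᶜ.Connected := by
  have mem_A_of_notMem_B : ∀ z ∉ B, z ∈ A := fun z hz =>
    (Set.eq_univ_iff_forall.1 hAB z).resolve_right hz
  have hyB : y ∈ B := (Set.eq_univ_iff_forall.1 hAB y).resolve_left hy
  have adj_y : ∀ a ∉ B, G.Adj a y := fun a ha =>
    (hA x (mem_A_of_notMem_B x hx) a (mem_A_of_notMem_B a ha) y hy).1 hxy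
  have adj_B : ∀ b ∈ B, ∀ a ∉ B, G.Adj b a := fun b hb a ha =>
    (hB y hyB b hb a ha).1 (adj_y a ha).symm
  exact not_connected_of_forall_not_adj ⟨y, hyB⟩ ((Set.ne_univ_iff_exists_notMem B).2 ⟨x, hx⟩)
    fun b hb a ha hadj => hadj.2 (adj_B b hb a ha)

theorem IsModule.union_ne_univ (hG : G.Connected) (hG' : Gᶜ.Connected) (hA : IsModule G A)
    (hB : IsModule G B) (hA' : A ≠ Set.univ) (hB' : B ≠ Set.univ) : A ∪ B ≠ Set.univ := by
  intro hAB
  obtain ⟨y, hy⟩ := (Set.ne_univ_iff_exists_notMem A).1 hA'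
  obtain ⟨x, hx⟩ := (Set.ne_univ_iff_exists_notMem B).1 hB'
  by_cases hxy : G.Adj x y
  · exact hA.not_connected_compl hB hAB hx hy hxy hG'
  · have hne : x ≠ y := by
      rintro rfl
      exact (Set.eq_univ_iff_forall.1 hAB x).elim hy hx
    exact hA.compl.not_connected_compl hB.compl hAB hx hy ⟨hne, hxy⟩ (by rwa [compl_compl])

theorem IsMaxProperModule.eq_of_inter_nonempty (hG : G.Connected) (hG' : Gᶜ.Connected)
    (hA : IsMaxProperModule G A) (hB : IsMaxProperModule G B) (hAB : (A ∩ B).Nonempty) :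
    A = B := by
  have hunion : IsModule G (A ∪ B) ∧ A ∪ B ≠ Set.univ :=
    ⟨hA.prop.1.union hB.prop.1 hAB,
      hA.prop.1.union_ne_univ hG hG' hB.prop.1 hA.prop.2 hB.prop.2⟩
  exact (hA.eq_of_subset hunion Set.subset_union_left).trans
    (hB.eq_of_subset hunion Set.subset_union_right).symm

theorem isPartition_isMaxProperModule [Finite V] [Nontrivial V] (hG : G.Connected)
    (hG' : Gᶜ.Connected) : Setoid.IsPartition {K | IsMaxProperModule G K} := by
  refine ⟨fun h => (IsMaxProperModule.nonempty h).ne_empty rfl, fun x => ?_⟩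
  obtain ⟨K, hK, hxK⟩ := exists_isMaxProperModule_mem G x
  exact ⟨K, ⟨hK, hxK⟩, fun L hL => hL.1.eq_of_inter_nonempty hG hG' hK ⟨x, hL.2, hxK⟩⟩

end MaxProperModules

/-! ### Modular partitions -/

/-- `P` is a partition of `M` into modules of the induced subgraph `G ↾ M`. -/
structure IsModularPartition (G : SimpleGraph V) (M : Set V) (P : Set (Set V)) : Prop where
  sUnion_eq : ⋃₀ P = M
  pairwiseDisjoint : P.PairwiseDisjoint id
  nonempty : ∀ N : P, N.1.Nonempty
  isModule : ∀ N : P, IsModule (G.induce M) (Subtype.val ⁻¹' N.1)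

/-- The parts of `P` that meet `S`, a set of vertices of the quotient graph on `P`. -/
def trace (P : Set (Set V)) (S : Set V) : Set P :=
  {N | (S ∩ N.1).Nonempty}

namespace IsModularPartition

variable {G : SimpleGraph V} {M S X : Set V} {P : Set (Set V)} {C : Set P} {N N' : P} {x y : V}

theorem image_val {𝒦 : Set (Set M)} (h𝒦 : Setoid.IsPartition 𝒦)
    (hmod : ∀ K ∈ 𝒦, IsModule (G.induce M) K) :
    IsModularPartition G M ((Subtype.val '' ·) '' 𝒦) where
  sUnion_eq := by
    rw [Set.sUnion_image, ← Set.image_iUnion₂, ← Set.sUnion_eq_biUnion, h𝒦.sUnion_eq_univ,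
      Subtype.coe_image_univ]
  pairwiseDisjoint := by
    rintro _ ⟨K, hK, rfl⟩ _ ⟨L, hL, rfl⟩ hne
    exact (Set.disjoint_image_iff Subtype.val_injective).2
      (h𝒦.pairwiseDisjoint hK hL fun h => hne (by rw [h]))
  nonempty := by
    rintro ⟨_, K, hK, rfl⟩
    exact (Setoid.nonempty_of_mem_partition h𝒦 hK).image _
  isModule := by
    rintro ⟨_, K, hK, rfl⟩
    rw [Set.preimage_image_eq K Subtype.val_injective]
    exact hmod K hK

theorem compl (h : IsModularPartition G M P) : IsModularPartition Gᶜ M P where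
  sUnion_eq := h.sUnion_eq
  pairwiseDisjoint := h.pairwiseDisjoint
  nonempty := h.nonempty
  isModule N := compl_induce G M ▸ (h.isModule N).compl

theorem subset (h : IsModularPartition G M P) (N : P) : N.1 ⊆ M :=
  h.sUnion_eq ▸ Set.subset_sUnion_of_mem N.2

theorem exists_mem (h : IsModularPartition G M P) (hx : x ∈ M) : ∃ N : P, x ∈ N.1 := by
  obtain ⟨N, hN, hxN⟩ := h.sUnion_eq.symm ▸ hx
  exact ⟨⟨N, hN⟩, hxN⟩

theorem nonempty_coe (h : IsModularPartition G M P) (hM : M.Nonempty) : Nonempty P :=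
  (h.exists_mem hM.some_mem).nonempty

theorem notMem_of_ne (h : IsModularPartition G M P) (hne : N ≠ N') (hx : x ∈ N.1) : x ∉ N'.1 :=
  (h.pairwiseDisjoint N.2 N'.2 (Subtype.coe_ne_coe.2 hne)).notMem_of_mem_left hx

theorem quotientGraph_adj_iff (h : IsModularPartition G M P) (hne : N ≠ N') (hx : x ∈ N.1)
    (hy : y ∈ N'.1) : (quotientGraph G P).Adj N N' ↔ G.Adj x y := by
  refine ⟨fun hadj => hadj.2 x hx y hy, fun hxy => ⟨hne, fun x' hx' y' hy' => ?_⟩⟩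
  have hx'y : G.Adj x' y := ((h.isModule N).adj_iff_of_induce (h.subset N) hx hx'
    (h.subset N' hy) (h.notMem_of_ne hne.symm hy)).1 hxy
  exact (((h.isModule N').adj_iff_of_induce (h.subset N') hy hy'
    (h.subset N hx') (h.notMem_of_ne hne hx')).1 hx'y.symm).symm

theorem quotientGraph_compl (h : IsModularPartition G M P) :
    quotientGraph Gᶜ P = (quotientGraph G P)ᶜ := by
  ext N N'
  rcases eq_or_ne N N' with rfl | hne
  · simp
  obtain ⟨x, hx⟩ := h.nonempty N
  obtain ⟨y, hy⟩ := h.nonempty N'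
  have hxy : x ≠ y := ne_of_mem_of_not_mem hx (h.notMem_of_ne hne.symm hy)
  simp only [h.compl.quotientGraph_adj_iff hne hx hy, SimpleGraph.compl_adj,
    h.quotientGraph_adj_iff hne hx hy, ne_eq, hne, hxy, not_false_eq_true, true_and]

theorem isClique_trace (h : IsModularPartition G M P) (hS : G.IsClique S) :
    (quotientGraph G P).IsClique (trace P S) := by
  rintro N ⟨x, hxS, hxN⟩ N' ⟨y, hyS, hyN'⟩ hne
  exact (h.quotientGraph_adj_iff hne hxN hyN').2
    (hS hxS hyS (ne_of_mem_of_not_mem hxN (h.notMem_of_ne hne.symm hyN')))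

theorem trace_mem_MC (h : IsModularPartition G M P) (hS : S ∈ MCOn G M) :
    trace P S ∈ MC (quotientGraph G P) := by
  refine mem_MC_iff.2 ⟨h.isClique_trace (isClique_of_mem_MCOn hS), fun N hN => ?_⟩
  by_contra hNS
  obtain ⟨x, hx⟩ := h.nonempty N
  refine hNS ⟨x, (mem_MCOn_iff.1 hS).2.2 x (h.subset N hx) fun s hs _ => ?_, hx⟩
  obtain ⟨N', hsN'⟩ := h.exists_mem (subset_of_mem_MCOn hS hs)
  have hN'S : N' ∈ trace P S := ⟨s, hs, hsN'⟩
  exact (hN N' hN'S fun hNN' => hNS (hNN' ▸ hN'S)).2 x hx s hsN'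

theorem inter_mem_MCOn (h : IsModularPartition G M P) (hS : S ∈ MCOn G M) (hN : N ∈ trace P S) :
    S ∩ N.1 ∈ MCOn G N.1 := by
  obtain ⟨hSM, hclique, hmax⟩ := mem_MCOn_iff.1 hS
  refine mem_MCOn_iff.2 ⟨Set.inter_subset_right, hclique.inter_left _,
    fun x hx hadj => ⟨hmax x (h.subset N hx) fun s hs hne => ?_, hx⟩⟩
  by_cases hsN : s ∈ N.1
  · exact hadj s ⟨hs, hsN⟩ hne
  · obtain ⟨y, hyS, hyN⟩ := hN
    exact ((h.isModule N).adj_iff_of_induce (h.subset N) hyN hx (hSM hs) hsN).1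
      (hclique hyS hs (ne_of_mem_of_not_mem hyN hsN))

theorem isClique_iUnion (hC : (quotientGraph G P).IsClique C) {f : P → Set V}
    (hsub : ∀ N ∈ C, f N ⊆ N.1) (hf : ∀ N ∈ C, G.IsClique (f N)) :
    G.IsClique (⋃ N ∈ C, f N) := by
  intro x hx y hy hne
  simp only [Set.mem_iUnion] at hx hy
  obtain ⟨N, hN, hx⟩ := hx
  obtain ⟨N', hN', hy⟩ := hy
  rcases eq_or_ne N N' with rfl | hNN'
  · exact hf N hN hx hy hne
  · exact (hC hN hN' hNN').2 x (hsub N hN hx) y (hsub N' hN' hy)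

theorem iUnion_mem_MCOn (h : IsModularPartition G M P) (hC : C ∈ MC (quotientGraph G P))
    {f : P → Set V} (hf : ∀ N ∈ C, f N ∈ MCOn G N.1) : (⋃ N ∈ C, f N) ∈ MCOn G M := by
  obtain ⟨hclique, hmax⟩ := mem_MC_iff.1 hC
  have hsub : ∀ N ∈ C, f N ⊆ N.1 := fun N hN => subset_of_mem_MCOn (hf N hN)
  refine mem_MCOn_iff.2 ⟨Set.iUnion₂_subset fun N hN => (hsub N hN).trans (h.subset N),
    isClique_iUnion hclique hsub fun N hN => isClique_of_mem_MCOn (hf N hN), fun x hx hadj => ?_⟩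
  simp only [Set.mem_iUnion] at hadj ⊢
  obtain ⟨N, hxN⟩ := h.exists_mem hx
  have hNC : N ∈ C := by
    refine hmax N fun N' hN' hne => ?_
    obtain ⟨y, hy⟩ := nonempty_of_mem_MCOn (h.nonempty N') (hf N' hN')
    have hyN' : y ∈ N'.1 := hsub N' hN' hy
    exact (h.quotientGraph_adj_iff hne hxN hyN').2
      (hadj y ⟨N', hN', hy⟩ (ne_of_mem_of_not_mem hxN (h.notMem_of_ne hne.symm hyN')))
  exact ⟨N, hNC, (mem_MCOn_iff.1 (hf N hNC)).2.2 x hxN fun s hs => hadj s ⟨N, hNC, hs⟩⟩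

theorem evalsToOneOn_iff (h : IsModularPartition G M P) :
    EvalsToOneOn G M X ↔ EvalsToOne (quotientGraph G P) {N | EvalsToOneOn G N.1 X} := by
  constructor
  · rintro ⟨S, hS, hSX⟩
    exact ⟨trace P S, h.trace_mem_MC hS, fun N hN =>
      ⟨S ∩ N.1, h.inter_mem_MCOn hS hN, Set.inter_subset_left.trans hSX⟩⟩
  · rintro ⟨C, hC, hCX⟩
    have hclique : ∀ N ∈ C, ∃ S, S ∈ MCOn G N.1 ∧ S ⊆ X := fun N hN => hCX hN
    choose! f hf hfX using hclique
    exact ⟨⋃ N ∈ C, f N, h.iUnion_mem_MCOn hC hf, Set.iUnion₂_subset hfX⟩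

end IsModularPartition

theorem components_eq_image_supp (G : SimpleGraph V) (M : Set V) :
    components G M = (Subtype.val '' ·) ''
      Set.range (SimpleGraph.ConnectedComponent.supp (G := G.induce M)) := by
  ext N
  simp [components, eq_comm]

theorem isPartition_range_supp (G : SimpleGraph V) :
    Setoid.IsPartition (Set.range (SimpleGraph.ConnectedComponent.supp (G := G))) := by
  refine ⟨?_, fun x => ⟨(G.connectedComponentMk x).supp, ⟨⟨_, rfl⟩, rfl⟩, ?_⟩⟩
  · rintro ⟨c, hc⟩
    exact c.nonempty_supp.ne_empty hc
  · rintro _ ⟨⟨c, rfl⟩, rfl⟩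
    rfl

theorem isModule_supp {G : SimpleGraph V} (c : G.ConnectedComponent) : IsModule G c.supp :=
  fun _ hx _ hy _ hz => iff_of_false (fun h => hz ((c.mem_supp_congr_adj h).1 hx))
    fun h => hz ((c.mem_supp_congr_adj h).1 hy)

theorem isModularPartition_components (G : SimpleGraph V) (M : Set V) :
    IsModularPartition G M (components G M) := by
  rw [components_eq_image_supp]
  refine .image_val (isPartition_range_supp _) ?_
  rintro _ ⟨c, rfl⟩
  exact isModule_supp c

theorem quotientGraph_components (G : SimpleGraph V) (M : Set V) :
    quotientGraph G (components G M) = ⊥ := by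
  refine SimpleGraph.eq_bot_iff_forall_not_adj.2 ?_
  rintro ⟨_, c, rfl⟩ ⟨_, d, rfl⟩ ⟨hne, hadj⟩
  obtain ⟨x, hx⟩ := c.nonempty_supp
  obtain ⟨y, hy⟩ := d.nonempty_supp
  have hxy : (G.induce M).Adj x y := hadj x ⟨x, hx, rfl⟩ y ⟨y, hy, rfl⟩
  have hcd : c = d := hx.symm.trans ((d.mem_supp_congr_adj hxy).2 hy)
  exact hne (by simp only [hcd])

theorem isModularPartition_components_compl (G : SimpleGraph V) (M : Set V) :
    IsModularPartition G M (components Gᶜ M) := by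
  simpa using (isModularPartition_components Gᶜ M).compl

theorem quotientGraph_components_compl (G : SimpleGraph V) (M : Set V) :
    quotientGraph G (components Gᶜ M) = ⊤ := by
  simpa [quotientGraph_components] using (isModularPartition_components Gᶜ M).quotientGraph_compl

theorem isModularPartition_maxProperModules [Finite V] {G : SimpleGraph V} {M : Set V}
    (hM : M.Nontrivial) (hG : (G.induce M).Connected) (hG' : (Gᶜ.induce M).Connected) :
    IsModularPartition G M (maxProperModules G M) := by
  have := hM.coe_sort
  have himage : maxProperModules G M =
      (Subtype.val '' ·) '' {K | IsMaxProperModule (G.induce M) K} := by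
    ext N
    simp only [maxProperModules, IsMaxProperModule, Set.mem_ofPred_eq, Set.mem_image, eq_comm]
  rw [himage]
  exact .image_val (isPartition_isMaxProperModule hG (compl_induce G M ▸ hG'))
    fun K (hK : IsMaxProperModule (G.induce M) K) => hK.prop.1

/-! ### Modular decomposition trees -/

/-- `t` is obtained from `G ↾ M` by repeatedly partitioning into modules, until single vertices are
reached. An edgeless (complete) quotient may be recorded as a `∨` (`∧`) node, and, in contrast to
`decTreeOn`, the partitions are otherwise arbitrary. -/
inductive IsModularTree (G : SimpleGraph V) : Set V → DecTree V → Prop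
  | leaf (x : V) : IsModularTree G {x} (.leaf x)
  | or {M : Set V} {P : Set (Set V)} {child : P → DecTree V} (hM : M.Nonempty)
      (hP : IsModularPartition G M P) (hQ : quotientGraph G P = ⊥)
      (hchild : ∀ N : P, IsModularTree G N.1 (child N)) : IsModularTree G M (.or P child)
  | and {M : Set V} {P : Set (Set V)} {child : P → DecTree V} (hM : M.Nonempty)
      (hP : IsModularPartition G M P) (hQ : quotientGraph G P = ⊤)
      (hchild : ∀ N : P, IsModularTree G N.1 (child N)) : IsModularTree G M (.and P child)
  | prime {M : Set V} {P : Set (Set V)} {child : P → DecTree V}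
      (hP : IsModularPartition G M P) (hchild : ∀ N : P, IsModularTree G N.1 (child N)) :
      IsModularTree G M (.prime P (quotientGraph G P) child)

theorem isModularTree_decTreeOn [Finite V] (G : SimpleGraph V) {M : Set V} (hM : M.Nonempty) :
    IsModularTree G M (decTreeOn G M) := by
  induction M using decTreeOn.induct G with
  | case1 M hsingle =>
    rw [decTreeOn, dif_pos hsingle]
    have hx := hsingle.choose_spec
    generalize hsingle.choose = x at hx ⊢
    subst hx
    exact .leaf x
  | case2 M hsingle hd ih =>
    have hP := isModularPartition_components G M
    rw [decTreeOn, dif_neg hsingle, dif_pos hd]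
    exact .or hM hP (quotientGraph_components G M) fun N => ih N (hP.nonempty N)
  | case3 M hsingle hd hc ih =>
    have hP := isModularPartition_components_compl G M
    rw [decTreeOn, dif_neg hsingle, dif_neg hd, dif_pos hc]
    exact .and hM hP (quotientGraph_components_compl G M) fun N => ih N (hP.nonempty N)
  | case4 M hsingle hd hc ih =>
    have hnontrivial : M.Nontrivial := hM.exists_eq_singleton_or_nontrivial.resolve_left hsingle
    have hP := isModularPartition_maxProperModules hnontrivial (not_not.1 hd) (not_not.1 hc)
    rw [decTreeOn, dif_neg hsingle, dif_neg hd, dif_neg hc]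
    exact .prime hP fun N => ih N (hP.nonempty N)

theorem isModularTree_decTree [Finite V] [Nonempty V] (G : SimpleGraph V) :
    IsModularTree G Set.univ (decTree G) :=
  isModularTree_decTreeOn G Set.univ_nonempty

/-! ### Drawing strategies -/

namespace EloiseStrategy

variable {P : Set (Set V)} {Q : SimpleGraph P} {child : P → DecTree V} {X : Set V}

theorem isDrawing_leaf {x : V} (σ : EloiseStrategy (.leaf x)) : σ.IsDrawing X ↔ x ∈ X := by
  constructor
  · intro h
    simpa [Play.EloiseWins, Play.IsDraw, Play.outcome] using h (.leaf x) trivial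
  · rintro hx ⟨⟩ -
    exact Or.inl ⟨x, hx, rfl⟩

theorem isDrawing_or (σ : EloiseStrategy (.or P child)) :
    σ.IsDrawing X ↔ EloiseStrategy.IsDrawing (σ.2 σ.1) X := by
  constructor
  · intro h p hp
    exact h (.or σ.1 p) ⟨rfl, hp⟩
  · rintro h (_ | ⟨i, p⟩) ⟨rfl, hp⟩
    exact h p hp

theorem isDrawing_and (σ : EloiseStrategy (.and P child)) :
    σ.IsDrawing X ↔ ∀ i, EloiseStrategy.IsDrawing (σ i) X := by
  constructor
  · intro h i p hp
    exact h (.and i p) hp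
  · rintro h (_ | _ | ⟨i, p⟩) hp
    exact h i p hp

-- Every element of the clique lies in some maximal stable set, so Abelard can steer the play to it.
theorem isDrawing_prime (σ : EloiseStrategy (.prime P Q child)) :
    σ.IsDrawing X ↔ ∀ i ∈ σ.1.1, EloiseStrategy.IsDrawing (σ.2 i) X := by
  constructor
  · intro h i hi p hp
    obtain ⟨T, hT, hiT⟩ := exists_mem_MS_mem Q i
    exact h (.prime σ.1 ⟨T, hT⟩ i ⟨hi, hiT⟩ p) ⟨rfl, hp⟩
  · rintro h (_ | _ | _ | _ | ⟨S, T, i, hi, p⟩) hp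
    · exact Or.inr rfl
    · obtain ⟨rfl, hp⟩ := hp
      exact h i hi.1 p hp

theorem exists_isDrawing_leaf {x : V} :
    (∃ σ : EloiseStrategy (.leaf x), σ.IsDrawing X) ↔ x ∈ X :=
  ⟨fun ⟨σ, hσ⟩ => σ.isDrawing_leaf.1 hσ, fun hx => ⟨PUnit.unit, (isDrawing_leaf _).2 hx⟩⟩

theorem exists_isDrawing_or [∀ i, Nonempty (EloiseStrategy (child i))] :
    (∃ σ : EloiseStrategy (.or P child), σ.IsDrawing X) ↔
      ∃ i, ∃ σ : EloiseStrategy (child i), σ.IsDrawing X := by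
  constructor
  · rintro ⟨σ, hσ⟩
    exact ⟨σ.1, σ.2 σ.1, σ.isDrawing_or.1 hσ⟩
  · rintro ⟨i, σ, hσ⟩
    classical
    refine ⟨(i, Function.update (fun _ => Classical.ofNonempty) i σ), (isDrawing_or _).2 ?_⟩
    simpa using hσ

theorem exists_isDrawing_and :
    (∃ σ : EloiseStrategy (.and P child), σ.IsDrawing X) ↔
      ∀ i, ∃ σ : EloiseStrategy (child i), σ.IsDrawing X := by
  constructor
  · rintro ⟨σ, hσ⟩ i
    exact ⟨σ i, σ.isDrawing_and.1 hσ i⟩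
  · intro h
    choose σ hσ using h
    exact ⟨σ, (isDrawing_and _).2 hσ⟩

theorem exists_isDrawing_prime [∀ i, Nonempty (EloiseStrategy (child i))] :
    (∃ σ : EloiseStrategy (.prime P Q child), σ.IsDrawing X) ↔
      EvalsToOne Q {i | ∃ σ : EloiseStrategy (child i), σ.IsDrawing X} := by
  constructor
  · rintro ⟨σ, hσ⟩
    exact ⟨σ.1, σ.1.2, fun i hi => ⟨σ.2 i, σ.isDrawing_prime.1 hσ i hi⟩⟩
  · rintro ⟨C, hC, hdraw⟩
    have hchild : ∀ i ∈ C, ∃ σ : EloiseStrategy (child i), σ.IsDrawing X := fun i hi => hdraw hi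
    choose! σ hσ using hchild
    exact ⟨(⟨C, hC⟩, σ), (isDrawing_prime _).2 hσ⟩

end EloiseStrategy

theorem IsModularTree.nonempty_eloiseStrategy {G : SimpleGraph V} {M : Set V} {t : DecTree V}
    (ht : IsModularTree G M t) : Nonempty (EloiseStrategy t) := by
  induction ht with
  | leaf x => exact ⟨PUnit.unit⟩
  | or hM hP _ _ ih => exact ⟨((hP.nonempty_coe hM).some, fun N => (ih N).some)⟩
  | and _ _ _ _ ih => exact ⟨fun N => (ih N).some⟩
  | @prime _ P _ _ _ ih =>
    exact ⟨((MC_nonempty (quotientGraph G P)).to_subtype.some, fun N => (ih N).some)⟩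

theorem IsModularTree.evalsToOneOn_iff {G : SimpleGraph V} {M X : Set V} {t : DecTree V}
    (ht : IsModularTree G M t) :
    EvalsToOneOn G M X ↔ ∃ σ : EloiseStrategy t, σ.IsDrawing X := by
  induction ht with
  | leaf x => rw [evalsToOneOn_singleton, EloiseStrategy.exists_isDrawing_leaf]
  | or hM hP hQ hchild ih =>
    have := fun N => (hchild N).nonempty_eloiseStrategy
    have := hP.nonempty_coe hM
    rw [hP.evalsToOneOn_iff, hQ, evalsToOne_bot, EloiseStrategy.exists_isDrawing_or]
    exact exists_congr ih
  | and _ hP hQ hchild ih =>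
    rw [hP.evalsToOneOn_iff, hQ, evalsToOne_top, EloiseStrategy.exists_isDrawing_and,
      Set.eq_univ_iff_forall]
    exact forall_congr' ih
  | prime hP hchild ih =>
    have := fun N => (hchild N).nonempty_eloiseStrategy
    simp only [hP.evalsToOneOn_iff, EloiseStrategy.exists_isDrawing_prime, ih]

/-! ### Duality -/

/-- The tree with the roles of the two players exchanged: `∨` and `∧` are swapped and the graphs at
prime nodes complemented. -/
def DecTree.dual : DecTree V → DecTree V
  | .leaf x => .leaf x
  | .or P child => .and P fun N => (child N).dual
  | .and P child => .or P fun N => (child N).dual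
  | .prime P Q child => .prime P Qᶜ fun N => (child N).dual

theorem IsModularTree.dual {G : SimpleGraph V} {M : Set V} {t : DecTree V}
    (ht : IsModularTree G M t) : IsModularTree Gᶜ M t.dual := by
  induction ht with
  | leaf x => exact .leaf x
  | or hM hP hQ _ ih => exact .and hM hP.compl (by rw [hP.quotientGraph_compl, hQ, compl_bot]) ih
  | and hM hP hQ _ ih => exact .or hM hP.compl (by rw [hP.quotientGraph_compl, hQ, compl_top]) ih
  | prime hP _ ih =>
    rw [DecTree.dual, ← hP.quotientGraph_compl]
    exact .prime hP.compl ih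

/-- The play with the same moves, made by the opposite players, on the dual tree. -/
def Play.dual : {t : DecTree V} → Play t → Play t.dual
  | _, .leaf x => .leaf x
  | _, .or i p => .and i p.dual
  | _, .and i p => .or i p.dual
  | .prime _ Q _, .deadlock S T h =>
    .deadlock ⟨T, (MC_compl Q).ge T.2⟩ ⟨S, (MS_compl Q).ge S.2⟩ ((Set.inter_comm _ _).trans h)
  | .prime _ Q _, .prime S T i h p =>
    .prime ⟨T, (MC_compl Q).ge T.2⟩ ⟨S, (MS_compl Q).ge S.2⟩ i h.symm p.dual

theorem Play.outcome_dual {t : DecTree V} (p : Play t) : p.dual.outcome = p.outcome := by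
  induction p with
  | leaf _ => rfl
  | or _ _ ih => exact ih
  | and _ _ ih => exact ih
  | deadlock _ _ _ => rfl
  | prime _ _ _ _ _ ih => exact ih

theorem Play.dual_surjective : ∀ t : DecTree V, Function.Surjective (Play.dual (t := t))
  | .leaf x, .leaf _ => ⟨.leaf x, rfl⟩
  | .or _ child, .and i q => by
    obtain ⟨p, rfl⟩ := dual_surjective (child i) q
    exact ⟨.or i p, rfl⟩
  | .and _ child, .or i q => by
    obtain ⟨p, rfl⟩ := dual_surjective (child i) q
    exact ⟨.and i p, rfl⟩
  | .prime _ Q _, .deadlock S T h =>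
    ⟨.deadlock ⟨T, (MS_compl Q).le T.2⟩ ⟨S, (MC_compl Q).le S.2⟩
      ((Set.inter_comm _ _).trans h), rfl⟩
  | .prime _ Q child, .prime S T i h q => by
    obtain ⟨p, rfl⟩ := dual_surjective (child i) q
    exact ⟨.prime ⟨T, (MS_compl Q).le T.2⟩ ⟨S, (MC_compl Q).le S.2⟩ i h.symm p, rfl⟩

theorem Play.eloiseWins_dual {t : DecTree V} (p : Play t) {X : Set V} :
    p.dual.EloiseWins Xᶜ ↔ p.AbelardWins X := by
  simp only [EloiseWins, AbelardWins, outcome_dual, Set.mem_compl_iff]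

theorem Play.isDraw_dual {t : DecTree V} (p : Play t) : p.dual.IsDraw ↔ p.IsDraw := by
  simp only [IsDraw, outcome_dual]

namespace AbelardStrategy

/-- Abelard's strategies on a tree are Eloise's strategies on the dual tree. -/
def dualEquiv : (t : DecTree V) → AbelardStrategy t ≃ EloiseStrategy t.dual
  | .leaf _ => Equiv.refl _
  | .or _ child => Equiv.piCongrRight fun N => dualEquiv (child N)
  | .and P child => (Equiv.refl P).prodCongr (Equiv.piCongrRight fun N => dualEquiv (child N))
  | .prime _ Q child =>
    (Equiv.setCongr (MC_compl Q).symm).prodCongr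
      (Equiv.piCongrRight fun N => dualEquiv (child N))

theorem followsEloise_dual_iff {t : DecTree V} (p : Play t) (τ : AbelardStrategy t) :
    p.dual.FollowsEloise (dualEquiv t τ) ↔ p.FollowsAbelard τ := by
  induction p with
  | leaf _ => rfl
  | or i _ ih => exact ih (τ i)
  | and i _ ih => exact and_congr_right fun _ => ih (τ.2 i)
  | deadlock _ _ _ => exact (Equiv.setCongr (MC_compl _).symm).apply_eq_iff_eq
  | prime _ _ i _ _ ih =>
    exact and_congr (Equiv.setCongr (MC_compl _).symm).apply_eq_iff_eq (ih (τ.2 i))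

theorem isDrawing_dualEquiv_iff {t : DecTree V} (τ : AbelardStrategy t) {X : Set V} :
    (dualEquiv t τ).IsDrawing Xᶜ ↔ τ.IsDrawing X := by
  simp only [EloiseStrategy.IsDrawing, IsDrawing, (Play.dual_surjective t).forall,
    followsEloise_dual_iff, Play.eloiseWins_dual, Play.isDraw_dual]

theorem exists_isDrawing_dual_iff {t : DecTree V} {X : Set V} :
    (∃ σ : EloiseStrategy t.dual, σ.IsDrawing Xᶜ) ↔ ∃ τ : AbelardStrategy t, τ.IsDrawing X := by
  simp only [(dualEquiv t).surjective.exists, isDrawing_dualEquiv_iff]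

end AbelardStrategy

/-! ### Deterministic graphs -/

theorem deterministic_iff {G : SimpleGraph V} :
    Deterministic G ↔ ∀ S ∈ MC G, ∀ T ∈ MS G, (S ∩ T).Nonempty := by
  constructor
  · intro h S hS T hT
    by_contra! hST
    exact h S ⟨⟨T, hT, hST⟩, S, hS, subset_rfl⟩
  · rintro h X ⟨⟨T, hT, hXT⟩, S, hS, hSX⟩
    obtain ⟨x, hxS, hxT⟩ := h S hS T hT
    exact hXT.subset ⟨hSX hxS, hxT⟩

/-- The induced subgraph `G ↾ M` is deterministic, in the form of `deterministic_iff`. -/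
def DeterministicOn (G : SimpleGraph V) (M : Set V) : Prop :=
  ∀ S ∈ MCOn G M, ∀ T ∈ MCOn Gᶜ M, (S ∩ T).Nonempty

theorem deterministicOn_univ {G : SimpleGraph V} :
    DeterministicOn G Set.univ ↔ Deterministic G := by
  simp only [DeterministicOn, MCOn_univ, MC_compl, deterministic_iff]

theorem DeterministicOn.of_isModule {G : SimpleGraph V} {M N : Set V} (hdet : DeterministicOn G M)
    (hNM : N ⊆ M) (hN : IsModule (G.induce M) (Subtype.val ⁻¹' N)) (hne : N.Nonempty) :
    DeterministicOn G N := by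
  intro S hS T hT
  obtain ⟨S', hS', hSS'⟩ :=
    exists_mem_MCOn_superset ((subset_of_mem_MCOn hS).trans hNM) (isClique_of_mem_MCOn hS)
  obtain ⟨T', hT', hTT'⟩ :=
    exists_mem_MCOn_superset ((subset_of_mem_MCOn hT).trans hNM) (isClique_of_mem_MCOn hT)
  have hclique := isClique_of_mem_MCOn hS'
  have hstable := isClique_of_mem_MCOn hT'
  obtain ⟨x, hxS', hxT'⟩ := hdet S' hS' T' hT'
  by_cases hxN : x ∈ N
  · exact ⟨x, mem_of_mem_MCOn_of_subset_isClique hS hclique hSS' hxN hxS',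
      mem_of_mem_MCOn_of_subset_isClique hT hstable hTT' hxN hxT'⟩
  · obtain ⟨s, hs⟩ := nonempty_of_mem_MCOn hne hS
    obtain ⟨t, ht⟩ := nonempty_of_mem_MCOn hne hT
    have hsN := subset_of_mem_MCOn hS hs
    have htN := subset_of_mem_MCOn hT ht
    -- Outside `N`, the vertex `x` would be adjacent to all of `S` and to nothing in `T`.
    have hsx : G.Adj s x := hclique (hSS' hs) hxS' (ne_of_mem_of_not_mem hsN hxN)
    have htx : ¬ G.Adj t x := (hstable (hTT' ht) hxT' (ne_of_mem_of_not_mem htN hxN)).2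
    exact absurd
      ((hN.adj_iff_of_induce hNM hsN htN (subset_of_mem_MCOn hS' hxS') hxN).1 hsx) htx

namespace IsModularPartition

variable {G : SimpleGraph V} {M : Set V} {P : Set (Set V)}

theorem exists_mem_MCOn_trace_eq (h : IsModularPartition G M P) {C : Set P}
    (hC : C ∈ MC (quotientGraph G P)) : ∃ S ∈ MCOn G M, trace P S = C := by
  choose r hr using h.nonempty
  have hclique : G.IsClique (⋃ N ∈ C, {r N}) :=
    isClique_iUnion (mem_MC_iff.1 hC).1 (fun N _ => Set.singleton_subset_iff.2 (hr N))
      fun N _ => by simp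
  obtain ⟨S, hS, hrS⟩ := exists_mem_MCOn_superset
    (Set.iUnion₂_subset fun N _ => Set.singleton_subset_iff.2 (h.subset N (hr N))) hclique
  have hCS : C ⊆ trace P S := fun N hN =>
    ⟨r N, hrS (Set.mem_biUnion hN rfl), hr N⟩
  exact ⟨S, hS, (Maximal.eq_of_subset hC (h.isClique_trace (isClique_of_mem_MCOn hS)) hCS).symm⟩

theorem deterministicOn_part (h : IsModularPartition G M P) (hdet : DeterministicOn G M) (N : P) :
    DeterministicOn G N.1 :=
  hdet.of_isModule (h.subset N) (h.isModule N) (h.nonempty N)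

theorem deterministic_quotientGraph (h : IsModularPartition G M P) (hdet : DeterministicOn G M) :
    Deterministic (quotientGraph G P) := by
  rw [deterministic_iff, ← MC_compl, ← h.quotientGraph_compl]
  intro C hC D hD
  obtain ⟨S, hS, rfl⟩ := h.exists_mem_MCOn_trace_eq hC
  obtain ⟨T, hT, rfl⟩ := h.compl.exists_mem_MCOn_trace_eq hD
  obtain ⟨x, hxS, hxT⟩ := hdet S hS T hT
  obtain ⟨N, hxN⟩ := h.exists_mem (subset_of_mem_MCOn hS hxS)
  exact ⟨N, ⟨x, hxS, hxN⟩, ⟨x, hxT, hxN⟩⟩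

end IsModularPartition

theorem IsModularTree.not_isDraw {G : SimpleGraph V} {M : Set V} {t : DecTree V}
    (ht : IsModularTree G M t) (hdet : DeterministicOn G M) (p : Play t) : ¬ p.IsDraw := by
  induction ht with
  | leaf x =>
    cases p
    exact Option.some_ne_none x
  | or _ hP _ _ ih =>
    obtain _ | ⟨i, p⟩ := p
    exact ih i (hP.deterministicOn_part hdet i) p
  | and _ hP _ _ ih =>
    obtain _ | _ | ⟨i, p⟩ := p
    exact ih i (hP.deterministicOn_part hdet i) p
  | prime hP _ ih =>
    obtain _ | _ | _ | ⟨S, T, hST⟩ | ⟨S, T, i, -, p⟩ := p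
    · exact absurd hST
        (deterministic_iff.1 (hP.deterministic_quotientGraph hdet) S S.2 T T.2).ne_empty
    · exact ih i (hP.deterministicOn_part hdet i) p

theorem EloiseStrategy.isWinning_iff_isDrawing {t : DecTree V} (ht : ∀ p : Play t, ¬ p.IsDraw)
    (σ : EloiseStrategy t) {X : Set V} : σ.IsWinning X ↔ σ.IsDrawing X :=
  forall₂_congr fun p _ => (or_iff_left (ht p)).symm

theorem AbelardStrategy.isWinning_iff_isDrawing {t : DecTree V} (ht : ∀ p : Play t, ¬ p.IsDraw)
    (τ : AbelardStrategy t) {X : Set V} : τ.IsWinning X ↔ τ.IsDrawing X :=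
  forall₂_congr fun p _ => (or_iff_left (ht p)).symm

end BGL

theorem mainTheorem6_general {V : Type*} {G : SimpleGraph V} {t : BGL.DecTree V}
    (ht : BGL.IsModularTree G Set.univ t) (X : Set V) :
    (BGL.EvalsToOne G X ↔ ∃ σ : BGL.EloiseStrategy t, σ.IsDrawing X) ∧
    (BGL.EvalsToZero G X ↔ ∃ τ : BGL.AbelardStrategy t, τ.IsDrawing X) ∧
    (BGL.Deterministic G →
      (BGL.EvalsToOne G X ↔ ∃ σ : BGL.EloiseStrategy t, σ.IsWinning X) ∧
      (BGL.EvalsToZero G X ↔ ∃ τ : BGL.AbelardStrategy t, τ.IsWinning X)) := by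
  have hone : BGL.EvalsToOne G X ↔ ∃ σ : BGL.EloiseStrategy t, σ.IsDrawing X := by
    rw [← BGL.evalsToOneOn_univ, ht.evalsToOneOn_iff]
  have hzero : BGL.EvalsToZero G X ↔ ∃ τ : BGL.AbelardStrategy t, τ.IsDrawing X := by
    rw [← BGL.evalsToOne_compl, ← BGL.evalsToOneOn_univ, ht.dual.evalsToOneOn_iff,
      BGL.AbelardStrategy.exists_isDrawing_dual_iff]
  refine ⟨hone, hzero, fun hdet => ?_⟩
  have hdraw : ∀ p : BGL.Play t, ¬ p.IsDraw := ht.not_isDraw (BGL.deterministicOn_univ.2 hdet)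
  simp only [BGL.EloiseStrategy.isWinning_iff_isDrawing hdraw,
    BGL.AbelardStrategy.isWinning_iff_isDrawing hdraw]
  exact ⟨hone, hzero⟩

theorem mainTheorem6 {V : Type*} [Finite V] [Nonempty V] (G : SimpleGraph V) (X : Set V) :
    (BGL.EvalsToOne G X ↔
      ∃ σ : BGL.EloiseStrategy (BGL.decTree G), BGL.EloiseStrategy.IsDrawing σ X) ∧
    (BGL.EvalsToZero G X ↔
      ∃ τ : BGL.AbelardStrategy (BGL.decTree G), BGL.AbelardStrategy.IsDrawing τ X) ∧
    (BGL.Deterministic G →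
      (BGL.EvalsToOne G X ↔
        ∃ σ : BGL.EloiseStrategy (BGL.decTree G), BGL.EloiseStrategy.IsWinning σ X) ∧
      (BGL.EvalsToZero G X ↔
        ∃ τ : BGL.AbelardStrategy (BGL.decTree G), BGL.AbelardStrategy.IsWinning τ X)) := by
  exact mainTheorem6_general (BGL.isModularTree_decTree G) X
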